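/- Let $\mathbb{K}$ be an algebraically closed field and $V$ a $\mathbb{K}$-vector space of finite positive dimension. For $A\in\mathrm{End}(V)$, an eigenspace of $A$ is a nonzero subspace of the form $\{v\in V: Av=\theta v\}$ with $\theta\in\mathbb{K}$, and $A$ is diagonalizable if $V$ is spanned by the eigenspaces of $A$. For $A,A^*\in\mathrm{End}(V)$ ($A^*$ is just a second linear map), an ordering $V_0,\dots,V_d$ of the eigenspaces of $A$ is called standard if $A^*V_i\subseteq V_{i-1}+V_i+V_{i+1}$ for $0\le i\le d$, where $V_{-1}=V_{d+1}=0$; standard orderings of the eigenspaces of $A^*$ are defined likewise with the roles of $A,A^*$ exchanged. The pair $A,A^*$ is a tridiagonal pair if $A$ and $A^*$ are diagonalizable, the eigenspaces of each have a standard ordering, and no subspace $W$ with $W\neq 0$, $W\ne V$ satisfies both $AW\subseteq W$ and $A^*W\subseteq W$. A tridiagonal system of diameter $d$ is a sequence $\Phi=(A;\{E_i\}_{i=0}^d;A^*;\{E_i^*\}_{i=0}^d)$ where $A,A^*$ is a tridiagonal pair on $V$ and $\{E_i\}$ (resp. $\{E^*_i\}$) are the projections onto the eigenspaces of $A$ (resp.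 $A^*$), along the sum of the other eigenspaces, taken in a standard ordering. Let $\Phi$ be a tridiagonal system of diameter $d\ge 1$ on $V$ that has $q$-Racah type: there are nonzero $q,a,b\in\mathbb{K}$ with $q^4\neq 1$ such that, for $0\le i\le d$, the eigenvalue of $A$ on $E_iV$ is $\theta_i=aq^{d-2i}+a^{-1}q^{2i-d}$ and the eigenvalue of $A^*$ on $E_i^*V$ is $\theta_i^*=bq^{d-2i}+b^{-1}q^{2i-d}$. For $0\le i\le d$ put $$U_i=(E_0^*V+\cdots+E_i^*V)\cap(E_iV+\cdots+E_dV),\qquad U_i^{\Downarrow}=(E_0^*V+\cdots+E_i^*V)\cap(E_0V+\cdots+E_{d-i}V).$$ Theorem. There is a unique $K\in\mathrm{End}(V)$ with $(K-q^{d-2i}I)U_i=0$ for $0\le i\le d$, and a unique $B\in\mathrm{End}(V)$ with $(B-q^{d-2i}I)U_i^{\Downarrow}=0$ for $0\le i\le d$. These maps satisfy $$aK^2-\frac{a^{-1}q-aq^{-1}}{q-q^{-1}}\,KB-\frac{aq-a^{-1}q^{-1}}{q-q^{-1}}\,BK+a^{-1}B^2=0,$$ and also the equivalent relation $$q(K-B)(aK-a^{-1}B)=q^{-1}(aK-a^{-1}B)(K-B).$$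 -/

import Mathlib

namespace TD

variable {𝕂 : Type*} {V : Type*} [Field 𝕂] [AddCommGroup V] [Module 𝕂 V]

/-- `W` is an eigenspace of `A`: it is nonzero and of the form `{v | A v = θ v}`. -/
def IsEigenspace (A : Module.End 𝕂 V) (W : Submodule 𝕂 V) : Prop :=
  W ≠ ⊥ ∧ ∃ θ : 𝕂, W = A.eigenspace θ

/-- `A` is diagonalizable: `V` is spanned by the eigenspaces of `A`. -/
def IsDiagonalizable (A : Module.End 𝕂 V) : Prop :=
  sSup {W : Submodule 𝕂 V | IsEigenspace A W} = ⊤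

/-- `W 0, …, W d` is an ordering of the eigenspaces of `A` (each of them listed exactly once) which
is standard with respect to `X`, that is, `X W_i ⊆ W_{i-1} + W_i + W_{i+1}` for `0 ≤ i ≤ d`, where
`W_{-1} = W_{d+1} = 0`. -/
structure IsStandardOrdering (A X : Module.End 𝕂 V) {d : ℕ}
    (W : Fin (d + 1) → Submodule 𝕂 V) : Prop where
  injective : Function.Injective W
  range_eq : Set.range W = {W' : Submodule 𝕂 V | IsEigenspace A W'}
  tridiagonal : ∀ i : Fin (d + 1), (W i).map X ≤
    ⨆ j : Fin (d + 1), ⨆ _ : (i : ℕ) ≤ (j : ℕ) + 1 ∧ (j : ℕ) ≤ (i : ℕ) + 1, W j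

/-- Tridiagonal pairs on `V` (which is meant to have finite positive dimension). -/
structure IsTDPair (A Astar : Module.End 𝕂 V) : Prop where
  diagonalizable : IsDiagonalizable A
  diagonalizable_star : IsDiagonalizable Astar
  exists_ordering : ∃ (d : ℕ) (W : Fin (d + 1) → Submodule 𝕂 V), IsStandardOrdering A Astar W
  exists_ordering_star :
    ∃ (δ : ℕ) (W : Fin (δ + 1) → Submodule 𝕂 V), IsStandardOrdering Astar A W
  irreducible : ¬ ∃ W : Submodule 𝕂 V,
    W.map A ≤ W ∧ W.map Astar ≤ W ∧ W ≠ ⊥ ∧ W ≠ ⊤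

/-- `E 0, …, E d` is a standard ordering of the primitive idempotents of `A`: for a standard
ordering `W 0, …, W d` of the eigenspaces of `A`, each `E i` is the projection onto `W i` that
vanishes on `W j` for all `j ≠ i`. -/
def IsStandardIdempotents (A X : Module.End 𝕂 V) {d : ℕ}
    (E : Fin (d + 1) → Module.End 𝕂 V) : Prop :=
  ∃ W : Fin (d + 1) → Submodule 𝕂 V, IsStandardOrdering A X W ∧
    ∀ i, (∀ v ∈ W i, E i v = v) ∧ ∀ j, j ≠ i → ∀ v ∈ W j, E i v = 0

end TD

/-- A tridiagonal system `(A; {E_i}; A*; {E*_i})` on `V`, of diameter `d`. -/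
structure TDSystem (𝕂 V : Type*) [Field 𝕂] [AddCommGroup V] [Module 𝕂 V] (d : ℕ) where
  A : Module.End 𝕂 V
  E : Fin (d + 1) → Module.End 𝕂 V
  Astar : Module.End 𝕂 V
  Estar : Fin (d + 1) → Module.End 𝕂 V
  isTDPair : TD.IsTDPair A Astar
  standard : TD.IsStandardIdempotents A Astar E
  standard_star : TD.IsStandardIdempotents Astar A Estar

namespace TDSystem

variable {𝕂 : Type*} {V : Type*} [Field 𝕂] [AddCommGroup V] [Module 𝕂 V] {d : ℕ}

/-- `θ 0, …, θ d` is the eigenvalue sequence of `Φ`: `E_i V` is the eigenspace of `A` for `θ i`.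
(As `E_i V ≠ 0`, this determines `θ`.) -/
def IsEigenvalueSeq (Φ : TDSystem 𝕂 V d) (θ : Fin (d + 1) → 𝕂) : Prop :=
  ∀ i, LinearMap.range (Φ.E i) = Φ.A.eigenspace (θ i)

/-- `θ 0, …, θ d` is the dual eigenvalue sequence of `Φ`. -/
def IsDualEigenvalueSeq (Φ : TDSystem 𝕂 V d) (θ : Fin (d + 1) → 𝕂) : Prop :=
  ∀ i, LinearMap.range (Φ.Estar i) = Φ.Astar.eigenspace (θ i)

/-- `Φ` has `q`-Racah type, with parameters `q, a, b`. -/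
structure IsQRacah (Φ : TDSystem 𝕂 V d) (q a b : 𝕂) : Prop where
  q_ne_zero : q ≠ 0
  a_ne_zero : a ≠ 0
  b_ne_zero : b ≠ 0
  q_pow_four_ne_one : q ^ 4 ≠ 1
  eigenvalue : Φ.IsEigenvalueSeq fun i =>
    a * q ^ ((d : ℤ) - 2 * (i : ℤ)) + a⁻¹ * q ^ (2 * (i : ℤ) - (d : ℤ))
  dual_eigenvalue : Φ.IsDualEigenvalueSeq fun i =>
    b * q ^ ((d : ℤ) - 2 * (i : ℤ)) + b⁻¹ * q ^ (2 * (i : ℤ) - (d : ℤ))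

/-- First split decomposition:
`U_i = (E*_0 V + ⋯ + E*_i V) ∩ (E_i V + ⋯ + E_d V)`. -/
def U (Φ : TDSystem 𝕂 V d) (i : Fin (d + 1)) : Submodule 𝕂 V :=
  (⨆ j : Fin (d + 1), ⨆ _ : (j : ℕ) ≤ (i : ℕ), LinearMap.range (Φ.Estar j)) ⊓
    (⨆ j : Fin (d + 1), ⨆ _ : (i : ℕ) ≤ (j : ℕ), LinearMap.range (Φ.E j))

/-- Second split decomposition:
`U_i^⇓ = (E*_0 V + ⋯ + E*_i V) ∩ (E_0 V + ⋯ + E_{d-i} V)`. -/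
def Udd (Φ : TDSystem 𝕂 V d) (i : Fin (d + 1)) : Submodule 𝕂 V :=
  (⨆ j : Fin (d + 1), ⨆ _ : (j : ℕ) ≤ (i : ℕ), LinearMap.range (Φ.Estar j)) ⊓
    (⨆ j : Fin (d + 1), ⨆ _ : (j : ℕ) + (i : ℕ) ≤ d, LinearMap.range (Φ.E j))

/-- The defining property of `K`: `(K - q^{d-2i} I) U_i = 0` for `0 ≤ i ≤ d`. -/
def IsK (Φ : TDSystem 𝕂 V d) (q : 𝕂) (K : Module.End 𝕂 V) : Prop :=
  ∀ i : Fin (d + 1), ∀ v ∈ Φ.U i, K v = q ^ ((d : ℤ) - 2 * (i : ℤ)) • v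

/-- The defining property of `B`: `(B - q^{d-2i} I) U_i^⇓ = 0` for `0 ≤ i ≤ d`. -/
def IsB (Φ : TDSystem 𝕂 V d) (q : 𝕂) (B : Module.End 𝕂 V) : Prop :=
  ∀ i : Fin (d + 1), ∀ v ∈ Φ.Udd i, B v = q ^ ((d : ℤ) - 2 * (i : ℤ)) • v

end TDSystem

/-!
Let `X = q (K - B)(a K - a⁻¹ B) - q⁻¹ (a K - a⁻¹ B)(K - B)`. Expanding shows that `X` is `q - q⁻¹`
times the left side of the quadratic relation (`qDefect_eq`), so both relations say that `X = 0`.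
This is deduced from the irreducibility of `V` under `A, A*`.

*Split decompositions.* Put `V(n, m) = (E*_0 V + ⋯ + E*_n V) ∩ (E_m V + ⋯ + E_d V)` for integers
`n, m` (`splitInter`). Then `A - θ_m` maps `V(n, m)` into `V(n+1, m+1)` and `A* - θ*_n` maps it
into `V(n-1, m-1)`, so for each `r` the sum of the `V(n, n+r)` is invariant under `A` and `A*`,
hence it is `0` or `V`. It contains `E*_0 V` if `r = 0`, and lies in `E_1 V + ⋯ + E_d V` if `r ≥
1`. So the `U_n = V(n, n)` span `V`, and `V(n, m) = 0` for `n < m`, which makes the sum direct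
(`iSup_splitInter_self`, `iSupIndep_splitInter`). So `K` exists and is unique. Reversing the order
of the `E_i` replaces `U` by `U^⇓`, `K` by `B` and `a` by `a⁻¹`, and the same results apply.

*Skew commutation.* As `A - θ_n` raises and `A* - θ*_n` lowers the decomposition `U`, the map `K`
satisfies `K A = q⁻² A K + (1 - q⁻²)(a K² + a⁻¹)` and `K A* = q² A* K + (1 - q²)(b K² + b⁻¹)`; for
`B` the first relation has `a⁻¹` in place of `a`, the second is the same (`raise_relation`,
`lower_relation`).

*The ideal of `X`.* A computation from these four relations, valid since `a² ≠ 1` (which is `θ_0 ≠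
θ_d`), gives `X A = q⁻⁴ A X + P X + X Q` and `X A* = q⁴ A* X + P' X + X Q'` with `P, Q, P', Q'`
linear combinations of `K` and `B` (`qDefect_mul_of_raising`, `qDefect_mul_of_lowering`). Hence
the space of all `v` with `X p v = 0` for every `p` in the algebra generated by `K` and `B` is
invariant under `A` and `A*` (`map_adjoinKer_le`). It contains `E*_0 V = U_0 = U_0^⇓`, on which
`K` and `B` act as the same scalar, so it is all of `V`, and `X = 0`.
-/

namespace TD

/-! ### Algebras generated by two elements with skew commutation relations -/

section Relation

variable {𝕂 R : Type*} [Field 𝕂] [Ring R] [Algebra 𝕂 R]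

/-- The difference of the two sides of the relation
`q (K - B)(a K - a⁻¹ B) = q⁻¹ (a K - a⁻¹ B)(K - B)`. -/
def qDefect (q a : 𝕂) (K B : R) : R :=
  q • ((K - B) * (a • K - a⁻¹ • B)) - q⁻¹ • ((a • K - a⁻¹ • B) * (K - B))

theorem qDefect_eq {q : 𝕂} (a : 𝕂) (hq : q - q⁻¹ ≠ 0) (K B : R) :
    qDefect q a K B = (q - q⁻¹) • (a • K ^ 2 - ((a⁻¹ * q - a * q⁻¹) / (q - q⁻¹)) • (K * B)
      - ((a * q - a⁻¹ * q⁻¹) / (q - q⁻¹)) • (B * K) + a⁻¹ • B ^ 2) := by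
  simp only [qDefect, mul_sub, sub_mul, smul_mul_assoc, mul_smul_comm, pow_two, smul_sub, smul_add,
    smul_smul, mul_div_cancel₀ _ hq]
  module

theorem mul_mul_of_skew {s e e' f f' : 𝕂} {Y Z M : R}
    (hY : Y * M = s • (M * Y) + (1 - s) • (e • Y ^ 2 + e' • 1))
    (hZ : Z * M = s • (M * Z) + (1 - s) • (f • Z ^ 2 + f' • 1)) :
    Y * Z * M = s ^ 2 • (M * (Y * Z)) + (1 - s) •
      (s • (e • (Y * (Y * Z)) + e' • Z) + (f • (Y * (Z * Z)) + f' • Y)) := by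
  rw [mul_assoc, hZ, mul_add, mul_smul_comm, ← mul_assoc, hY]
  simp only [smul_mul_assoc, mul_smul_comm, pow_two, smul_add, mul_add, add_mul, mul_assoc,
    mul_one, one_mul]
  module

/-- When `M` is moved to the left past `X = qDefect q a K B`, the correction terms linear in `K, B`
cancel, and the cubic ones are a combination of `K X`, `B X`, `X K` and `X B`. -/
theorem qDefect_mul_of_lowering {q a b : 𝕂} (hq : q ≠ 0) (ha : a ≠ 0)
    (ha2 : a ^ 2 - 1 ≠ 0) {K B M : R}
    (hK : K * M = q ^ 2 • (M * K) + (1 - q ^ 2) • (b • K ^ 2 + b⁻¹ • 1))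
    (hB : B * M = q ^ 2 • (M * B) + (1 - q ^ 2) • (b • B ^ 2 + b⁻¹ • 1)) :
    ∃ x y : 𝕂, qDefect q a K B * M = q ^ 4 • (M * qDefect q a K B)
      + (x • K + y • B) * qDefect q a K B + qDefect q a K B * (y • K + x • B) := by
  -- The coefficients are found by comparing the monomials of degree three in `K, B`.
  refine ⟨b * (1 - q ^ 2) * (a ^ 2 - q ^ 2) / (a ^ 2 - 1),
    b * (1 - q ^ 2) * (a ^ 2 * q ^ 2 - 1) / (a ^ 2 - 1), ?_⟩
  have h1 := mul_mul_of_skew hK hK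
  have h2 := mul_mul_of_skew hK hB
  have h3 := mul_mul_of_skew hB hK
  have h4 := mul_mul_of_skew hB hB
  simp only [qDefect, mul_sub, sub_mul, smul_mul_assoc, mul_smul_comm, smul_sub, smul_add,
    mul_add, add_mul, h1, h2, h3, h4]
  simp only [mul_assoc]
  match_scalars <;> field_simp <;> ring

/-- The analogue of `qDefect_mul_of_lowering` with `q⁻¹` in place of `q` in the skew commutation
relations, and with the inverse parameters `a` and `a⁻¹` for `K` and `B`. -/
theorem qDefect_mul_of_raising {q a : 𝕂} (hq : q ≠ 0) (ha : a ≠ 0)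
    (ha2 : a ^ 2 - 1 ≠ 0) {K B M : R}
    (hK : K * M = (q⁻¹) ^ 2 • (M * K) + (1 - (q⁻¹) ^ 2) • (a • K ^ 2 + a⁻¹ • 1))
    (hB : B * M = (q⁻¹) ^ 2 • (M * B) + (1 - (q⁻¹) ^ 2) • (a⁻¹ • B ^ 2 + a • 1)) :
    ∃ x y z w : 𝕂, qDefect q a K B * M = (q⁻¹) ^ 4 • (M * qDefect q a K B)
      + (x • K + y • B) * qDefect q a K B + qDefect q a K B * (z • K + w • B) := by
  refine ⟨(1 - (q⁻¹) ^ 2) * (a ^ 2 * q⁻¹ - q) * q⁻¹ * a / (a ^ 2 - 1),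
    (1 - (q⁻¹) ^ 2) * (a ^ 2 * q - q⁻¹) * q⁻¹ * a⁻¹ / (a ^ 2 - 1),
    (1 - (q⁻¹) ^ 2) * (a ^ 2 * q - q⁻¹) * q⁻¹ * a / (a ^ 2 - 1),
    (1 - (q⁻¹) ^ 2) * (a ^ 2 * q⁻¹ - q) * q⁻¹ * a⁻¹ / (a ^ 2 - 1), ?_⟩
  have h1 := mul_mul_of_skew hK hK
  have h2 := mul_mul_of_skew hK hB
  have h3 := mul_mul_of_skew hB hK
  have h4 := mul_mul_of_skew hB hB
  simp only [qDefect, mul_sub, sub_mul, smul_mul_assoc, mul_smul_comm, smul_sub, smul_add,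
    mul_add, add_mul, h1, h2, h3, h4]
  simp only [mul_assoc]
  match_scalars <;> field_simp <;> ring

/-- If `S` is the algebra generated by `K` and `B`, then `S M ⊆ M S + S`. -/
theorem exists_adjoin_mul_eq {s e e' f f' : 𝕂} {K B M : R}
    (hK : K * M = s • (M * K) + (1 - s) • (e • K ^ 2 + e' • 1))
    (hB : B * M = s • (M * B) + (1 - s) • (f • B ^ 2 + f' • 1))
    {p : R} (hp : p ∈ Algebra.adjoin 𝕂 {K, B}) :
    ∃ p₁ ∈ Algebra.adjoin 𝕂 {K, B}, ∃ p₂ ∈ Algebra.adjoin 𝕂 {K, B}, p * M = M * p₁ + p₂ := by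
  set S := Algebra.adjoin 𝕂 {K, B}
  have hKS : K ∈ S := Algebra.subset_adjoin (by simp)
  have hBS : B ∈ S := Algebra.subset_adjoin (by simp)
  induction hp using Algebra.adjoin_induction with
  | mem x hx =>
    rcases hx with rfl | rfl
    · refine ⟨s • x, S.smul_mem hKS s, _, ?_, by rw [hK, mul_smul_comm]⟩
      exact S.smul_mem (S.add_mem (S.smul_mem (S.pow_mem hKS 2) _) (S.smul_mem S.one_mem _)) _
    · refine ⟨s • x, S.smul_mem hBS s, _, ?_, by rw [hB, mul_smul_comm]⟩
      exact S.smul_mem (S.add_mem (S.smul_mem (S.pow_mem hBS 2) _) (S.smul_mem S.one_mem _)) _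
  | algebraMap r =>
    exact ⟨algebraMap 𝕂 R r, S.algebraMap_mem r, 0, S.zero_mem, by
      rw [Algebra.commutes, add_zero]⟩
  | add x y _ _ hx hy =>
    obtain ⟨x₁, hx₁, x₂, hx₂, hx⟩ := hx
    obtain ⟨y₁, hy₁, y₂, hy₂, hy⟩ := hy
    exact ⟨x₁ + y₁, S.add_mem hx₁ hy₁, x₂ + y₂, S.add_mem hx₂ hy₂, by
      rw [add_mul, hx, hy, mul_add]; abel⟩
  | mul x y hxS _ hx hy =>
    obtain ⟨x₁, hx₁, x₂, hx₂, hx⟩ := hx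
    obtain ⟨y₁, hy₁, y₂, hy₂, hy⟩ := hy
    refine ⟨x₁ * y₁, S.mul_mem hx₁ hy₁, x₂ * y₁ + x * y₂,
      S.add_mem (S.mul_mem hx₂ hy₁) (S.mul_mem hxS hy₂), ?_⟩
    rw [mul_assoc, hy, mul_add, ← mul_assoc, hx]
    noncomm_ring

end Relation

/-! ### The split decomposition -/

section Split

variable {𝕂 V : Type*} [Field 𝕂] [AddCommGroup V] [Module 𝕂 V] {d : ℕ}

/-- `W 0 + ⋯ + W n`, for any integer `n`: it is `0` for `n < 0` and the sum of all `W j` for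
`n ≥ d`. -/
def lowerSum (W : Fin (d + 1) → Submodule 𝕂 V) (n : ℤ) : Submodule 𝕂 V :=
  ⨆ j : Fin (d + 1), ⨆ _ : (j : ℤ) ≤ n, W j

/-- `W m + ⋯ + W d`, for any integer `m`: it is the sum of all `W j` for `m ≤ 0` and `0` for
`m > d`. -/
def upperSum (W : Fin (d + 1) → Submodule 𝕂 V) (m : ℤ) : Submodule 𝕂 V :=
  ⨆ j : Fin (d + 1), ⨆ _ : m ≤ (j : ℤ), W j

theorem le_lowerSum (W : Fin (d + 1) → Submodule 𝕂 V) {n : ℤ} {j : Fin (d + 1)}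
    (h : (j : ℤ) ≤ n) : W j ≤ lowerSum W n :=
  le_iSup₂_of_le j h le_rfl

theorem le_upperSum (W : Fin (d + 1) → Submodule 𝕂 V) {m : ℤ} {j : Fin (d + 1)}
    (h : m ≤ (j : ℤ)) : W j ≤ upperSum W m :=
  le_iSup₂_of_le j h le_rfl

theorem lowerSum_le {W : Fin (d + 1) → Submodule 𝕂 V} {n : ℤ} {T : Submodule 𝕂 V}
    (h : ∀ j : Fin (d + 1), (j : ℤ) ≤ n → W j ≤ T) : lowerSum W n ≤ T :=
  iSup₂_le h

theorem upperSum_le {W : Fin (d + 1) → Submodule 𝕂 V} {m : ℤ} {T : Submodule 𝕂 V}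
    (h : ∀ j : Fin (d + 1), m ≤ (j : ℤ) → W j ≤ T) : upperSum W m ≤ T :=
  iSup₂_le h

theorem lowerSum_mono (W : Fin (d + 1) → Submodule 𝕂 V) : Monotone (lowerSum W) :=
  fun _ _ h => lowerSum_le fun _ hj => le_lowerSum W (hj.trans h)

theorem upperSum_anti (W : Fin (d + 1) → Submodule 𝕂 V) : Antitone (upperSum W) :=
  fun _ _ h => upperSum_le fun _ hj => le_upperSum W (h.trans hj)

theorem lowerSum_of_neg (Ws : Fin (d + 1) → Submodule 𝕂 V) {n : ℤ} (hn : n < 0) :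
    lowerSum Ws n = ⊥ :=
  le_bot_iff.1 (lowerSum_le fun j hj => by omega)

theorem upperSum_of_gt (W : Fin (d + 1) → Submodule 𝕂 V) {m : ℤ} (hm : (d : ℤ) < m) :
    upperSum W m = ⊥ :=
  le_bot_iff.1 (upperSum_le fun j hj => by omega)

/-- The intersection of `Ws 0 + ⋯ + Ws n` with `W m + ⋯ + W d`. -/
def splitInter (W Ws : Fin (d + 1) → Submodule 𝕂 V) (n m : ℤ) : Submodule 𝕂 V :=
  lowerSum Ws n ⊓ upperSum W m

/-- `W` and `Ws` are families of spaces of eigenvectors of `A` and `As`, with eigenvalues `θ` and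
`θs`, on which the other map acts in a tridiagonal manner; `V` is the direct sum of the `W j`, and
`V` is irreducible under `A` and `As`. Not assuming `W` to be in a particular one of its two
standard orders lets both split decompositions be instances. The eigenvalue sequences are indexed
by all integers, so that the raising and lowering properties hold without boundary cases; only
their values on `0, …, d` carry information. -/
structure IsSplitData (A As : Module.End 𝕂 V) (θ θs : ℤ → 𝕂)
    (W Ws : Fin (d + 1) → Submodule 𝕂 V) : Prop where
  apply_eq : ∀ j, ∀ v ∈ W j, A v = θ j • v
  apply_star_eq : ∀ j, ∀ v ∈ Ws j, As v = θs j • v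
  tridiagonal : ∀ i, (W i).map As ≤
    ⨆ j : Fin (d + 1), ⨆ _ : (i : ℕ) ≤ (j : ℕ) + 1 ∧ (j : ℕ) ≤ (i : ℕ) + 1, W j
  tridiagonal_star : ∀ i, (Ws i).map A ≤
    ⨆ j : Fin (d + 1), ⨆ _ : (i : ℕ) ≤ (j : ℕ) + 1 ∧ (j : ℕ) ≤ (i : ℕ) + 1, Ws j
  iSup_eq_top : ⨆ j, W j = ⊤
  iSupIndep : iSupIndep W
  bot_ne : W 0 ≠ ⊥
  bot_ne_star : Ws 0 ≠ ⊥
  irreducible : ∀ T : Submodule 𝕂 V, T.map A ≤ T → T.map As ≤ T → T = ⊥ ∨ T = ⊤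

namespace IsSplitData

variable {A As : Module.End 𝕂 V} {θ θs : ℤ → 𝕂} {W Ws : Fin (d + 1) → Submodule 𝕂 V}

theorem map_lowerSum (h : IsSplitData A As θ θs W Ws) (n : ℤ) :
    (lowerSum Ws n).map A ≤ lowerSum Ws (n + 1) := by
  rw [Submodule.map_le_iff_le_comap]
  refine lowerSum_le fun j hj => Submodule.map_le_iff_le_comap.1 ?_
  refine (h.tridiagonal_star j).trans (iSup₂_le fun k hk => le_lowerSum Ws ?_)
  omega

theorem map_star_upperSum (h : IsSplitData A As θ θs W Ws) (m : ℤ) :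
    (upperSum W m).map As ≤ upperSum W (m - 1) := by
  rw [Submodule.map_le_iff_le_comap]
  refine upperSum_le fun j hj => Submodule.map_le_iff_le_comap.1 ?_
  refine (h.tridiagonal j).trans (iSup₂_le fun k hk => le_upperSum W ?_)
  omega

theorem sub_apply_mem_upperSum (h : IsSplitData A As θ θs W Ws) {m : ℤ} {v : V}
    (hv : v ∈ upperSum W m) : A v - θ m • v ∈ upperSum W (m + 1) := by
  suffices upperSum W m ≤ (upperSum W (m + 1)).comap (A - θ m • 1) from this hv
  refine upperSum_le fun j hj w hw => ?_
  have : (A - θ m • 1) w = (θ j - θ m) • w := by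
    simp [h.apply_eq j w hw, sub_smul]
  rw [Submodule.mem_comap, this]
  rcases hj.eq_or_lt with rfl | hlt
  · simp
  · exact Submodule.smul_mem _ _ (le_upperSum W (by omega) hw)

theorem sub_apply_mem_lowerSum (h : IsSplitData A As θ θs W Ws) {n : ℤ} {v : V}
    (hv : v ∈ lowerSum Ws n) : As v - θs n • v ∈ lowerSum Ws (n - 1) := by
  suffices lowerSum Ws n ≤ (lowerSum Ws (n - 1)).comap (As - θs n • 1) from this hv
  refine lowerSum_le fun j hj w hw => ?_
  have : (As - θs n • 1) w = (θs j - θs n) • w := by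
    simp [h.apply_star_eq j w hw, sub_smul]
  rw [Submodule.mem_comap, this]
  rcases hj.eq_or_lt with rfl | hlt
  · simp
  · exact Submodule.smul_mem _ _ (le_lowerSum Ws (by omega) hw)

theorem raise (h : IsSplitData A As θ θs W Ws) {n m : ℤ} {v : V}
    (hv : v ∈ splitInter W Ws n m) : A v - θ m • v ∈ splitInter W Ws (n + 1) (m + 1) :=
  ⟨sub_mem (h.map_lowerSum n (Submodule.mem_map_of_mem hv.1))
    (Submodule.smul_mem _ _ (lowerSum_mono Ws (by omega) hv.1)), h.sub_apply_mem_upperSum hv.2⟩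

theorem lower (h : IsSplitData A As θ θs W Ws) {n m : ℤ} {v : V}
    (hv : v ∈ splitInter W Ws n m) : As v - θs n • v ∈ splitInter W Ws (n - 1) (m - 1) :=
  ⟨h.sub_apply_mem_lowerSum hv.1, sub_mem (h.map_star_upperSum m (Submodule.mem_map_of_mem hv.2))
    (Submodule.smul_mem _ _ (upperSum_anti W (by omega) hv.2))⟩

/-- Each diagonal sum of the spaces `splitInter W Ws n m` is invariant under `A` and `As`, so it is
trivial by irreducibility. -/
theorem iSup_splitInter (h : IsSplitData A As θ θs W Ws) (r : ℤ) :
    ⨆ n, splitInter W Ws n (n + r) = ⊥ ∨ ⨆ n, splitInter W Ws n (n + r) = ⊤ := by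
  apply h.irreducible
  · rw [Submodule.map_iSup]
    refine iSup_le fun n => Submodule.map_le_iff_le_comap.2 fun v hv => ?_
    have h1 := h.raise hv
    rw [add_right_comm] at h1
    rw [Submodule.mem_comap, ← sub_add_cancel (A v) (θ (n + r) • v)]
    exact add_mem (le_iSup (fun n => splitInter W Ws n (n + r)) (n + 1) h1)
      (Submodule.smul_mem _ _ (le_iSup (fun n => splitInter W Ws n (n + r)) n hv))
  · rw [Submodule.map_iSup]
    refine iSup_le fun n => Submodule.map_le_iff_le_comap.2 fun v hv => ?_
    have h1 := h.lower hv
    rw [add_sub_right_comm] at h1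
    rw [Submodule.mem_comap, ← sub_add_cancel (As v) (θs n • v)]
    exact add_mem (le_iSup (fun n => splitInter W Ws n (n + r)) (n - 1) h1)
      (Submodule.smul_mem _ _ (le_iSup (fun n => splitInter W Ws n (n + r)) n hv))

theorem splitInter_zero (h : IsSplitData A As θ θs W Ws) : Ws 0 ≤ splitInter W Ws 0 0 := by
  refine le_inf (le_lowerSum Ws (by simp)) (le_top.trans ?_)
  rw [← h.iSup_eq_top]
  exact iSup_le fun j => le_upperSum W (by simp)

theorem iSup_splitInter_self (h : IsSplitData A As θ θs W Ws) :
    ⨆ n, splitInter W Ws n n = ⊤ := by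
  have h0 := h.iSup_splitInter 0
  simp only [add_zero] at h0
  refine h0.resolve_left fun hbot => h.bot_ne_star (le_bot_iff.1 ?_)
  rw [← hbot]
  exact h.splitInter_zero.trans (le_iSup (fun n => splitInter W Ws n n) 0)

theorem splitInter_eq_bot (h : IsSplitData A As θ θs W Ws) {n m : ℤ} (hnm : n < m) :
    splitInter W Ws n m = ⊥ := by
  have h0 := (h.iSup_splitInter (m - n)).resolve_right fun htop => ?_
  · refine le_bot_iff.1 (le_trans ?_ h0.le)
    exact le_iSup_of_le n (by rw [add_sub_cancel])
  -- The sum lies in `W 1 + ⋯ + W d`, so if it were `⊤`, then `W 0` would vanish by independence.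
  · have hle : upperSum W 1 = ⊤ := by
      refine top_le_iff.1 (htop.symm.le.trans (iSup_le fun k => ?_))
      rcases lt_or_ge k 0 with hk | hk
      · rw [splitInter, lowerSum_of_neg Ws hk, bot_inf_eq]
        exact bot_le
      · exact inf_le_right.trans (upperSum_anti W (by omega))
    have hdis := h.iSupIndep 0
    have : upperSum W 1 ≤ ⨆ j, ⨆ _ : j ≠ 0, W j :=
      upperSum_le fun j hj => le_iSup₂_of_le j (by rintro rfl; simp at hj) le_rfl
    rw [hle, top_le_iff] at this
    rw [this, disjoint_top] at hdis
    exact h.bot_ne hdis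

theorem iSupIndep_splitInter (h : IsSplitData A As θ θs W Ws) :
    _root_.iSupIndep fun n => splitInter W Ws n n := by
  rw [iSupIndep_iff_finsetSum_eq_zero_imp_eq_zero]
  intro s
  induction s using Finset.induction_on_max with
  | empty => simp
  | insert m s hs ih =>
    intro v hv hsum
    have hm : m ∉ s := fun hm => (hs m hm).false
    rw [Finset.sum_insert hm] at hsum
    -- `v m` is minus the sum of the terms below it, so it lies in `splitInter W Ws (m - 1) m`.
    have hvm : v m = 0 := by
      rw [← Submodule.mem_bot 𝕂, ← h.splitInter_eq_bot (sub_one_lt m)]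
      refine ⟨?_, (hv m (Finset.mem_insert_self m s)).2⟩
      rw [eq_neg_of_add_eq_zero_left hsum]
      refine neg_mem (sum_mem fun i hi => lowerSum_mono Ws (Int.le_sub_one_of_lt (hs i hi)) ?_)
      exact (hv i (Finset.mem_insert_of_mem hi)).1
    rw [hvm, zero_add] at hsum
    intro i hi
    rcases Finset.mem_insert.1 hi with rfl | hi
    · exact hvm
    · exact ih v (fun j hj => hv j (Finset.mem_insert_of_mem hj)) hsum i hi

theorem ext_splitInter (h : IsSplitData A As θ θs W Ws) {f g : Module.End 𝕂 V}
    (hfg : ∀ n, ∀ v ∈ splitInter W Ws n n, f v = g v) : f = g := by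
  rw [← LinearMap.eqLocus_eq_top, ← top_le_iff, ← h.iSup_splitInter_self]
  exact iSup_le hfg

theorem existsUnique_diagonal (h : IsSplitData A As θ θs W Ws) (c : ℤ → 𝕂) :
    ∃! K : Module.End 𝕂 V, ∀ n, ∀ v ∈ splitInter W Ws n n, K v = c n • v := by
  let e := h.iSupIndep_splitInter.linearEquiv h.iSup_splitInter_self
  refine ⟨DFinsupp.lsum ℕ (fun n => c n • (splitInter W Ws n n).subtype) ∘ₗ e.symm.toLinearMap,
    fun n v hv => ?_, fun K hK => ?_⟩
  · have : e.symm v = DFinsupp.single n ⟨v, hv⟩ :=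
      h.iSupIndep_splitInter.linearEquiv_symm_apply h.iSup_splitInter_self hv
    simp [this]
  · refine h.ext_splitInter fun n v hv => (hK n v hv).trans ?_
    have : e.symm v = DFinsupp.single n ⟨v, hv⟩ :=
      h.iSupIndep_splitInter.linearEquiv_symm_apply h.iSup_splitInter_self hv
    simp [this]

theorem lower_relation (h : IsSplitData A As θ θs W Ws) {q b : 𝕂} (hq : q ≠ 0)
    (hθ : ∀ n, θs n = b * q ^ ((d : ℤ) - 2 * n) + b⁻¹ * q ^ (2 * n - (d : ℤ)))
    {K : Module.End 𝕂 V}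
    (hK : ∀ n, ∀ v ∈ splitInter W Ws n n, K v = q ^ ((d : ℤ) - 2 * n) • v) :
    K * As = q ^ 2 • (As * K) + (1 - q ^ 2) • (b • K ^ 2 + b⁻¹ • 1) := by
  refine h.ext_splitInter fun n v hv => ?_
  obtain ⟨w, hw⟩ : ∃ w, As v - θs n • v = w := ⟨_, rfl⟩
  have hKw := hK _ _ (h.lower hv)
  rw [hw] at hKw
  rw [sub_eq_iff_eq_add] at hw
  have h1 : q ^ ((d : ℤ) - 2 * (n - 1)) = q ^ 2 * q ^ ((d : ℤ) - 2 * n) := by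
    rw [← zpow_natCast q 2, ← zpow_add₀ hq]; congr 1; push_cast; ring
  have h2 : q ^ (2 * n - (d : ℤ)) = (q ^ ((d : ℤ) - 2 * n))⁻¹ := by
    rw [← zpow_neg]; congr 1; ring
  have h3 : q ^ ((d : ℤ) - 2 * n) ≠ 0 := zpow_ne_zero _ hq
  simp only [pow_two K, Module.End.mul_apply, LinearMap.add_apply, LinearMap.smul_apply, hw,
    map_add, map_smul, hK n v hv, hKw, Module.End.one_apply, h1, hθ n, h2]
  match_scalars
  · field_simp
  · field_simp
    ring

theorem raise_relation (h : IsSplitData A As θ θs W Ws) {q a : 𝕂} (hq : q ≠ 0)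
    (hθ : ∀ n, θ n = a * q ^ ((d : ℤ) - 2 * n) + a⁻¹ * q ^ (2 * n - (d : ℤ)))
    {K : Module.End 𝕂 V}
    (hK : ∀ n, ∀ v ∈ splitInter W Ws n n, K v = q ^ ((d : ℤ) - 2 * n) • v) :
    K * A = q⁻¹ ^ 2 • (A * K) + (1 - q⁻¹ ^ 2) • (a • K ^ 2 + a⁻¹ • 1) := by
  refine h.ext_splitInter fun n v hv => ?_
  obtain ⟨w, hw⟩ : ∃ w, A v - θ n • v = w := ⟨_, rfl⟩
  have hKw := hK _ _ (h.raise hv)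
  rw [hw] at hKw
  rw [sub_eq_iff_eq_add] at hw
  have h1 : q ^ ((d : ℤ) - 2 * (n + 1)) = q⁻¹ ^ 2 * q ^ ((d : ℤ) - 2 * n) := by
    rw [inv_pow, ← zpow_natCast q 2, ← zpow_neg, ← zpow_add₀ hq]; congr 1; push_cast; ring
  have h2 : q ^ (2 * n - (d : ℤ)) = (q ^ ((d : ℤ) - 2 * n))⁻¹ := by
    rw [← zpow_neg]; congr 1; ring
  have h3 : q ^ ((d : ℤ) - 2 * n) ≠ 0 := zpow_ne_zero _ hq
  simp only [pow_two K, Module.End.mul_apply, LinearMap.add_apply, LinearMap.smul_apply, hw,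
    map_add, map_smul, hK n v hv, hKw, Module.End.one_apply, h1, hθ n, h2]
  match_scalars
  · field_simp
  · field_simp
    ring

end IsSplitData
end Split

/-! ### Vanishing by irreducibility -/

section Irreducible

variable {𝕂 V : Type*} [Field 𝕂] [AddCommGroup V] [Module 𝕂 V]

/-- The vectors `v` such that `X p v = 0` for all `p` in the algebra generated by `K` and `B`. -/
def adjoinKer (K B X : Module.End 𝕂 V) : Submodule 𝕂 V :=
  ⨅ p ∈ Algebra.adjoin 𝕂 {K, B}, LinearMap.ker (X * p)

theorem mem_adjoinKer {K B X : Module.End 𝕂 V} {v : V} :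
    v ∈ adjoinKer K B X ↔ ∀ p ∈ Algebra.adjoin 𝕂 {K, B}, X (p v) = 0 := by
  simp [adjoinKer]

/-- Moving `M` to the left past the algebra of `K, B` and past `X` produces only terms that kill
`adjoinKer K B X`. -/
theorem map_adjoinKer_le {K B X M P Q : Module.End 𝕂 V} {s e e' f f' t : 𝕂}
    (hK : K * M = s • (M * K) + (1 - s) • (e • K ^ 2 + e' • 1))
    (hB : B * M = s • (M * B) + (1 - s) • (f • B ^ 2 + f' • 1))
    (hQ : Q ∈ Algebra.adjoin 𝕂 {K, B}) (hX : X * M = t • (M * X) + P * X + X * Q) :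
    (adjoinKer K B X).map M ≤ adjoinKer K B X := by
  rw [Submodule.map_le_iff_le_comap]
  intro v hv
  rw [mem_adjoinKer] at hv
  refine mem_adjoinKer.2 fun p hp => ?_
  obtain ⟨p₁, hp₁, p₂, hp₂, h⟩ := exists_adjoin_mul_eq hK hB hp
  have h1 : p (M v) = M (p₁ v) + p₂ v := LinearMap.congr_fun h v
  have h2 := LinearMap.congr_fun hX (p₁ v)
  simp only [Module.End.mul_apply, LinearMap.add_apply, LinearMap.smul_apply, hv p₁ hp₁,
    map_zero, smul_zero, zero_add] at h2
  rw [h1, map_add, hv p₂ hp₂, h2, add_zero]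
  exact hv (Q * p₁) (mul_mem hQ hp₁)

theorem mem_adjoinKer_of_eigenvector {K B : Module.End 𝕂 V} {c : 𝕂} {v : V} (q a : 𝕂)
    (hK : K v = c • v) (hB : B v = c • v) : v ∈ adjoinKer K B (qDefect q a K B) := by
  refine mem_adjoinKer.2 fun p hp => ?_
  obtain ⟨x, hx⟩ : ∃ x : 𝕂, p v = x • v := by
    induction hp using Algebra.adjoin_induction with
    | mem y hy =>
      rcases hy with rfl | rfl
      exacts [⟨c, hK⟩, ⟨c, hB⟩]
    | algebraMap r => exact ⟨r, rfl⟩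
    | add y z _ _ hy hz =>
      obtain ⟨y₁, hy⟩ := hy
      obtain ⟨z₁, hz⟩ := hz
      exact ⟨y₁ + z₁, by rw [LinearMap.add_apply, hy, hz, add_smul]⟩
    | mul y z _ _ hy hz =>
      obtain ⟨y₁, hy⟩ := hy
      obtain ⟨z₁, hz⟩ := hz
      exact ⟨z₁ * y₁, by rw [Module.End.mul_apply, hz, map_smul, hy, smul_smul]⟩
  simp [hx, qDefect, hK, hB]

theorem qDefect_eq_zero {A As K B : Module.End 𝕂 V} {q a b c : 𝕂} {v : V} (hq : q ≠ 0)
    (ha : a ≠ 0) (ha2 : a ^ 2 - 1 ≠ 0)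
    (hKA : K * A = q⁻¹ ^ 2 • (A * K) + (1 - q⁻¹ ^ 2) • (a • K ^ 2 + a⁻¹ • 1))
    (hBA : B * A = q⁻¹ ^ 2 • (A * B) + (1 - q⁻¹ ^ 2) • (a⁻¹ • B ^ 2 + a • 1))
    (hKAs : K * As = q ^ 2 • (As * K) + (1 - q ^ 2) • (b • K ^ 2 + b⁻¹ • 1))
    (hBAs : B * As = q ^ 2 • (As * B) + (1 - q ^ 2) • (b • B ^ 2 + b⁻¹ • 1))
    (hv : v ≠ 0) (hKv : K v = c • v) (hBv : B v = c • v)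
    (hirr : ∀ T : Submodule 𝕂 V, T.map A ≤ T → T.map As ≤ T → T = ⊥ ∨ T = ⊤) :
    qDefect q a K B = 0 := by
  have hmem (x y : 𝕂) : x • K + y • B ∈ Algebra.adjoin 𝕂 {K, B} :=
    add_mem (Subalgebra.smul_mem _ (Algebra.subset_adjoin (by simp)) x)
      (Subalgebra.smul_mem _ (Algebra.subset_adjoin (by simp)) y)
  obtain ⟨x, y, z, w, h1⟩ := qDefect_mul_of_raising hq ha ha2 hKA hBA
  obtain ⟨x', y', h2⟩ := qDefect_mul_of_lowering hq ha ha2 hKAs hBAs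
  have hvm := mem_adjoinKer_of_eigenvector q a hKv hBv
  rcases hirr _ (map_adjoinKer_le hKA hBA (hmem z w) h1)
    (map_adjoinKer_le hKAs hBAs (hmem y' x') h2) with hbot | htop
  · rw [hbot, Submodule.mem_bot] at hvm
    exact absurd hvm hv
  · ext u
    have hu : u ∈ adjoinKer K B (qDefect q a K B) := htop ▸ Submodule.mem_top
    exact mem_adjoinKer.1 hu 1 (one_mem _)

end Irreducible

/-! ### Tridiagonal systems -/

section System

variable {𝕂 V : Type*} [Field 𝕂] [AddCommGroup V] [Module 𝕂 V] {d : ℕ}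

theorem IsStandardOrdering.iSup_eq_top {A X : Module.End 𝕂 V} {W : Fin (d + 1) → Submodule 𝕂 V}
    (h : IsStandardOrdering A X W) (hA : IsDiagonalizable A) : ⨆ j, W j = ⊤ := by
  rw [iSup, h.range_eq]
  exact hA

theorem IsStandardOrdering.ne_bot {A X : Module.End 𝕂 V} {W : Fin (d + 1) → Submodule 𝕂 V}
    (h : IsStandardOrdering A X W) (i : Fin (d + 1)) : W i ≠ ⊥ := by
  have : W i ∈ {W' | IsEigenspace A W'} := h.range_eq ▸ Set.mem_range_self i
  exact this.1

theorem IsStandardIdempotents.isStandardOrdering_range {A X : Module.End 𝕂 V}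
    {E : Fin (d + 1) → Module.End 𝕂 V} (h : IsStandardIdempotents A X E)
    (hA : IsDiagonalizable A) : IsStandardOrdering A X fun i => LinearMap.range (E i) := by
  obtain ⟨W, hW, hE⟩ := h
  suffices (fun i => LinearMap.range (E i)) = W from this ▸ hW
  ext1 i
  apply le_antisymm
  · rw [LinearMap.range_eq_map, ← hW.iSup_eq_top hA, Submodule.map_iSup]
    refine iSup_le fun j => Submodule.map_le_iff_le_comap.2 fun v hv => ?_
    rw [Submodule.mem_comap]
    rcases eq_or_ne j i with rfl | hj
    · rwa [(hE j).1 v hv]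
    · rw [(hE i).2 j hj v hv]
      exact zero_mem _
  · exact fun v hv => ⟨v, (hE i).1 v hv⟩

theorem IsStandardOrdering.iSupIndep {A X : Module.End 𝕂 V} {W : Fin (d + 1) → Submodule 𝕂 V}
    (h : IsStandardOrdering A X W) {θ : Fin (d + 1) → 𝕂} (hθ : ∀ i, W i = A.eigenspace (θ i)) :
    iSupIndep W := by
  have hinj : Function.Injective θ := fun i j hij => h.injective (by rw [hθ, hθ, hij])
  rw [show W = A.eigenspace ∘ θ from funext hθ]
  exact A.eigenspaces_iSupIndep.comp hinj

/-- The hypotheses on split data are preserved when the order of the spaces `W j` is reversed. -/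
theorem IsSplitData.rev {A As : Module.End 𝕂 V} {θ θs : ℤ → 𝕂}
    {W Ws : Fin (d + 1) → Submodule 𝕂 V} (h : IsSplitData A As θ θs W Ws)
    (hlast : W (Fin.last d) ≠ ⊥) :
    IsSplitData A As (fun n => θ (d - n)) θs (W ∘ Fin.rev) Ws where
  apply_eq j v hv := by
    have := h.apply_eq (Fin.rev j) v hv
    rwa [Fin.val_rev, show ((d + 1 - ((j : ℕ) + 1) : ℕ) : ℤ) = d - j by omega] at this
  apply_star_eq := h.apply_star_eq
  tridiagonal i := by
    refine (h.tridiagonal (Fin.rev i)).trans (iSup₂_le fun j hj => ?_)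
    refine le_iSup₂_of_le (Fin.rev j) ?_ (by simp)
    rw [Fin.val_rev] at hj ⊢
    omega
  tridiagonal_star := h.tridiagonal_star
  iSup_eq_top := by rw [← h.iSup_eq_top]; exact Equiv.iSup_comp (g := W) Fin.revPerm
  iSupIndep := h.iSupIndep.comp Fin.rev_injective
  bot_ne := by simpa using hlast
  bot_ne_star := h.bot_ne_star
  irreducible := h.irreducible

/-- The spaces `splitInter W Ws n n` with `n` outside `0, …, d` are zero, so statements about them
hold as soon as they hold for the zero vector. -/
theorem forall_splitInter_iff {W Ws : Fin (d + 1) → Submodule 𝕂 V}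
    {p : ℤ → V → Prop} (hp : ∀ n, p n 0) :
    (∀ n, ∀ v ∈ splitInter W Ws n n, p n v) ↔
      ∀ i : Fin (d + 1), ∀ v ∈ splitInter W Ws i i, p i v := by
  refine ⟨fun h i => h i, fun h n v hv => ?_⟩
  by_cases hn : 0 ≤ n ∧ n ≤ d
  · lift n to ℕ using hn.1
    exact h ⟨n, by omega⟩ v hv
  · have : v = 0 := by
      rcases not_and_or.1 hn with hn | hn
      · simpa [lowerSum_of_neg Ws (not_le.1 hn)] using hv.1
      · simpa [upperSum_of_gt W (not_le.1 hn)] using hv.2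
    exact this ▸ hp n

end System

end TD

namespace TDSystem

open TD

variable {𝕂 V : Type*} [Field 𝕂] [AddCommGroup V] [Module 𝕂 V] {d : ℕ}

theorem U_eq_splitInter (Φ : TDSystem 𝕂 V d) (i : Fin (d + 1)) :
    Φ.U i = splitInter (fun j => LinearMap.range (Φ.E j)) (fun j => LinearMap.range (Φ.Estar j))
      i i := by
  simp [U, splitInter, lowerSum, upperSum]

theorem Udd_eq_splitInter (Φ : TDSystem 𝕂 V d) (i : Fin (d + 1)) :
    Φ.Udd i = splitInter ((fun j => LinearMap.range (Φ.E j)) ∘ Fin.rev)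
      (fun j => LinearMap.range (Φ.Estar j)) i i := by
  have : upperSum ((fun j => LinearMap.range (Φ.E j)) ∘ Fin.rev) i =
      ⨆ j : Fin (d + 1), ⨆ _ : (j : ℕ) + (i : ℕ) ≤ d, LinearMap.range (Φ.E j) := by
    rw [upperSum, ← Equiv.iSup_comp Fin.revPerm]
    refine iSup_congr fun j => iSup_congr_Prop ?_ fun _ => by simp
    rw [Fin.revPerm_apply, Fin.val_rev]
    omega
  rw [splitInter, this]
  simp [Udd, lowerSum]

theorem isK_iff (Φ : TDSystem 𝕂 V d) {q : 𝕂} {K : Module.End 𝕂 V} :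
    Φ.IsK q K ↔ ∀ n, ∀ v ∈ splitInter (fun j => LinearMap.range (Φ.E j))
      (fun j => LinearMap.range (Φ.Estar j)) n n, K v = q ^ ((d : ℤ) - 2 * n) • v := by
  rw [forall_splitInter_iff (by simp)]
  simp only [IsK, U_eq_splitInter]

theorem isB_iff (Φ : TDSystem 𝕂 V d) {q : 𝕂} {B : Module.End 𝕂 V} :
    Φ.IsB q B ↔ ∀ n, ∀ v ∈ splitInter ((fun j => LinearMap.range (Φ.E j)) ∘ Fin.rev)
      (fun j => LinearMap.range (Φ.Estar j)) n n, B v = q ^ ((d : ℤ) - 2 * n) • v := by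
  rw [forall_splitInter_iff (by simp)]
  simp only [IsB, Udd_eq_splitInter]

theorem IsQRacah.isSplitData {Φ : TDSystem 𝕂 V d} {q a b : 𝕂} (h : Φ.IsQRacah q a b) :
    IsSplitData Φ.A Φ.Astar
      (fun n => a * q ^ ((d : ℤ) - 2 * n) + a⁻¹ * q ^ (2 * n - (d : ℤ)))
      (fun n => b * q ^ ((d : ℤ) - 2 * n) + b⁻¹ * q ^ (2 * n - (d : ℤ)))
      (fun j => LinearMap.range (Φ.E j)) (fun j => LinearMap.range (Φ.Estar j)) :=
  have hS := Φ.standard.isStandardOrdering_range Φ.isTDPair.diagonalizable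
  have hSs := Φ.standard_star.isStandardOrdering_range Φ.isTDPair.diagonalizable_star
  { apply_eq := fun j v hv => Module.End.mem_eigenspace_iff.1 (h.eigenvalue j ▸ hv)
    apply_star_eq := fun j v hv => Module.End.mem_eigenspace_iff.1 (h.dual_eigenvalue j ▸ hv)
    tridiagonal := hS.tridiagonal
    tridiagonal_star := hSs.tridiagonal
    iSup_eq_top := hS.iSup_eq_top Φ.isTDPair.diagonalizable
    iSupIndep := hS.iSupIndep h.eigenvalue
    bot_ne := hS.ne_bot 0
    bot_ne_star := hSs.ne_bot 0
    irreducible := fun T h1 h2 => by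
      by_contra hT
      rw [not_or] at hT
      exact Φ.isTDPair.irreducible ⟨T, h1, h2, hT⟩ }

theorem IsQRacah.isSplitData_rev {Φ : TDSystem 𝕂 V d} {q a b : 𝕂} (h : Φ.IsQRacah q a b) :
    IsSplitData Φ.A Φ.Astar
      (fun n => a⁻¹ * q ^ ((d : ℤ) - 2 * n) + a⁻¹⁻¹ * q ^ (2 * n - (d : ℤ)))
      (fun n => b * q ^ ((d : ℤ) - 2 * n) + b⁻¹ * q ^ (2 * n - (d : ℤ)))
      ((fun j => LinearMap.range (Φ.E j)) ∘ Fin.rev) (fun j => LinearMap.range (Φ.Estar j)) := by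
  have hS := Φ.standard.isStandardOrdering_range Φ.isTDPair.diagonalizable
  convert h.isSplitData.rev (hS.ne_bot (Fin.last d)) using 2 with n
  rw [inv_inv, add_comm, show (d : ℤ) - 2 * (d - n) = 2 * n - d by ring,
    show 2 * ((d : ℤ) - n) - d = d - 2 * n by ring]

/-- If `a² = 1`, then `θ_0 = θ_d`; this is where `d ≥ 1` matters. -/
theorem IsQRacah.sq_sub_one_ne_zero {Φ : TDSystem 𝕂 V d} {q a b : 𝕂} (h : Φ.IsQRacah q a b)
    (hd : 1 ≤ d) : a ^ 2 - 1 ≠ 0 := by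
  intro ha
  have hS := Φ.standard.isStandardOrdering_range Φ.isTDPair.diagonalizable
  have hinv : a⁻¹ = a := inv_eq_of_mul_eq_one_left (by linear_combination ha)
  have h0 : LinearMap.range (Φ.E 0) = LinearMap.range (Φ.E (Fin.last d)) := by
    rw [h.eigenvalue, h.eigenvalue]
    congr 1
    simp only [hinv, Fin.val_zero, Fin.val_last, Nat.cast_zero]
    rw [add_comm]
    congr 3 <;> ring
  have := congrArg Fin.val (hS.injective h0)
  simp at this
  omega

theorem IsQRacah.sub_inv_ne_zero {Φ : TDSystem 𝕂 V d} {q a b : 𝕂} (h : Φ.IsQRacah q a b) :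
    q - q⁻¹ ≠ 0 := by
  intro hq
  refine h.q_pow_four_ne_one ?_
  have := mul_inv_cancel₀ h.q_ne_zero
  rw [← sub_eq_zero.1 hq] at this
  linear_combination (q * q + 1) * this

end TDSystem

theorem theorem9p9 {𝕂 : Type*} {V : Type*} [Field 𝕂] [IsAlgClosed 𝕂] [AddCommGroup V]
    [Module 𝕂 V] [FiniteDimensional 𝕂 V] [Nontrivial V] {d : ℕ} (hd : 1 ≤ d)
    (Φ : TDSystem 𝕂 V d) (q a b : 𝕂) (hΦ : Φ.IsQRacah q a b) :
    (∃! K : Module.End 𝕂 V, Φ.IsK q K) ∧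
    (∃! B : Module.End 𝕂 V, Φ.IsB q B) ∧
    ∀ K B : Module.End 𝕂 V, Φ.IsK q K → Φ.IsB q B →
      a • K ^ 2 - ((a⁻¹ * q - a * q⁻¹) / (q - q⁻¹)) • (K * B)
          - ((a * q - a⁻¹ * q⁻¹) / (q - q⁻¹)) • (B * K) + a⁻¹ • B ^ 2 = 0 ∧
      q • ((K - B) * (a • K - a⁻¹ • B)) = q⁻¹ • ((a • K - a⁻¹ • B) * (K - B)) := by
  have h := hΦ.isSplitData
  have h' := hΦ.isSplitData_rev
  simp only [Φ.isK_iff, Φ.isB_iff]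
  refine ⟨h.existsUnique_diagonal _, h'.existsUnique_diagonal _, fun K B hK hB => ?_⟩
  obtain ⟨v, hv, hv0⟩ := Submodule.exists_mem_ne_zero_of_ne_bot h.bot_ne_star
  have hBA := h'.raise_relation hΦ.q_ne_zero (fun _ => rfl) hB
  rw [inv_inv] at hBA
  have hX : TD.qDefect q a K B = 0 :=
    TD.qDefect_eq_zero hΦ.q_ne_zero hΦ.a_ne_zero (hΦ.sq_sub_one_ne_zero hd)
      (h.raise_relation hΦ.q_ne_zero (fun _ => rfl) hK) hBA
      (h.lower_relation hΦ.q_ne_zero (fun _ => rfl) hK)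
      (h'.lower_relation hΦ.q_ne_zero (fun _ => rfl) hB) hv0
      (hK 0 v (h.splitInter_zero hv)) (hB 0 v (h'.splitInter_zero hv)) h.irreducible
  refine ⟨?_, sub_eq_zero.1 hX⟩
  rw [TD.qDefect_eq a hΦ.sub_inv_ne_zero] at hX
  exact (smul_eq_zero.1 hX).resolve_left hΦ.sub_inv_ne_zero
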